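/- Let $M$ be a smooth manifold (finite-dimensional, Hausdorff, second countable), let $R=C^\infty(M)$ and let $V=\mathrm{Der}_{\mathbb R}(R)$ be the $R$-module of smooth vector fields. Let $M$ be endowed with an affine connection, i.e. an $\mathbb R$-bilinear map $V\times V\to V$, $(X,Y)\mapsto X\rhd Y=\nabla_XY$, such that $\nabla_{fX}Y=f\nabla_XY$ and $\nabla_X(fY)=(X f)Y+f\nabla_XY$ for all $f\in R$. For $X\in V$ let $U\mapsto X\rhd U$ also denote the unique extension of $Y\mapsto X\rhd Y$ to a derivation of the tensor algebra $T_{\mathbb R}(V)$. The action $\rhd:T_{\mathbb R}(V)\times R\to R$ is the $\mathbb R$-bilinear map defined, recursively in the degree, by $$1\rhd f=f,\qquad X\rhd f=Xf,\qquad (X\cdot U)\rhd f=X\rhd(U\rhd f)-(X\rhd U)\rhd f\qquad (X\in V,\ U\in T_{\mathbb R}(V),\ f\in R).$$ Let $A=T_R(V)$ be the tensor algebra of $V$ over $R$, $\pi:T_{\mathbb R}(V)\to A$ the canonical algebra morphism which is the identity on $V$, and $\mathfrak g\subset A$ the $R$-Lie subalgebra generated by $V$ for the commutator bracket. Let $DM\subset\mathrm{End}_{\mathbb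 R}(R)$ be the algebra of differential operators, i.e. the subalgebra generated by the vector fields and the multiplication operators $\mu_f:g\mapsto fg$, $f\in R$; the $R$-module structure on operators is $(fT)(g)=f\,T(g)$. Theorem. (1) For every $n\ge 0$ the map $(X_1,\dots,X_n)\mapsto (X_1\cdots X_n)\rhd(\cdot)\in\mathrm{End}_{\mathbb R}(R)$ is $R$-linear in each of its arguments $X_1,\dots,X_n\in V$. (2) Consequently the action factors through $A$: there is an $R$-linear map $\rho:A\to\mathrm{End}_{\mathbb R}(R)$ with $\rho(\pi(U))f=U\rhd f$ for all $U\in T_{\mathbb R}(V)$ and $f\in R$. It satisfies $\rho(X)=X$ for $X\in V$, its image is exactly $DM$, so that it is a surjective $R$-linear map $\rho:A\to DM$, and $\rho(\mathfrak g)=V$ (vector fields regarded as operators on $R$), so that it restricts to a surjective map $\rho:\mathfrak g\to V$. -/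

import Mathlib

open scoped Manifold ContDiff TensorProduct

noncomputable section

/-- The module `V = Der R` of vector fields; for `R = C^∞(M)` it is the `R`-module (and real vector
space) of smooth vector fields on `M`, acting on functions by `X ▷ f = X f`. -/
abbrev VectorFields (R : Type*) [CommRing R] [Algebra ℝ R] : Type _ := Derivation ℝ R R

/-- An affine connection: an `ℝ`-bilinear map `(X, Y) ↦ X ▷ Y = ∇_X Y` on vector fields which is
`R`-linear in `X` and satisfies the Leibniz rule in `Y`. -/
structure AffineConnection (R : Type*) [CommRing R] [Algebra ℝ R] where
  toLin : VectorFields R →ₗ[ℝ] VectorFields R →ₗ[ℝ] VectorFields R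
  smul_left : ∀ (f : R) (X Y : VectorFields R), toLin (f • X) Y = f • toLin X Y
  leibniz : ∀ (f : R) (X Y : VectorFields R), toLin X (f • Y) = X f • Y + f • toLin X Y

/-- The algebra `DM` of differential operators: the subalgebra of the algebra of linear operators
on `R` generated by the vector fields and the multiplication operators `μ_f : g ↦ f g`. -/
def diffOps (R : Type*) [CommRing R] [Algebra ℝ R] : Subalgebra ℝ (Module.End ℝ R) :=
  Algebra.adjoin ℝ
    (Set.range (fun X : VectorFields R => (X : R →ₗ[ℝ] R)) ∪
      Set.range (fun f : R => LinearMap.mulLeft ℝ f))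

/-- The tensor algebra `A = T_R(V)` of the `R`-module of vector fields. -/
abbrev TensorFields (R : Type*) [CommRing R] [Algebra ℝ R] : Type _ :=
  TensorAlgebra R (VectorFields R)

/-- The natural map `π : T_ℝ(V) → A = T_R(V)`, the algebra morphism with `π X = X` on `V`. -/
def piProj (R : Type*) [CommRing R] [Algebra ℝ R] :
    TensorAlgebra ℝ (VectorFields R) →ₐ[ℝ] TensorFields R :=
  TensorAlgebra.lift ℝ ((TensorAlgebra.ι R (M := VectorFields R)).restrictScalars ℝ)

attribute [local instance] LieRing.ofAssociativeRing

/-- The `R`-Lie algebra `g`: the Lie subalgebra, for the commutator bracket, of `A = T_R(V)`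
generated by `V`. -/
def lieFields (R : Type*) [CommRing R] [Algebra ℝ R] : LieSubalgebra R (TensorFields R) :=
  LieSubalgebra.lieSpan R (TensorFields R)
    (Set.range (TensorAlgebra.ι R (M := VectorFields R)))

namespace AffineConnection

variable {R : Type*} [CommRing R] [Algebra ℝ R] (nabla : AffineConnection R)

theorem update_id_apply {V : Type*} [AddCommGroup V] [Module ℝ V] {n : ℕ} (A : V →ₗ[ℝ] V)
    (i : Fin n) (v : Fin n → V) :
    (fun j => (Function.update (fun _ => LinearMap.id) i A : Fin n → V →ₗ[ℝ] V) j (v j)) =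
      Function.update v i (A (v i)) := by
  ext1 j
  by_cases h : j = i
  · subst h; simp
  · simp [h]

/-- One step of the recursion. If `φ (v₁, …, vₙ) = (v₁ ⋯ vₙ) ▷ ·` is the action of monomials of
degree `n`, this is the map `(x, v) ↦ (x · v₁ ⋯ vₙ) ▷ ·` given by
`x ∘ φ (v₁, …, vₙ) - ∑ i, φ (v₁, …, ∇_x vᵢ, …, vₙ)`. -/
def covStep {n : ℕ} (φ : MultilinearMap ℝ (fun _ : Fin n => VectorFields R) (Module.End ℝ R)) :
    VectorFields R →ₗ[ℝ]
      MultilinearMap ℝ (fun _ : Fin n => VectorFields R) (Module.End ℝ R) where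
  toFun x := (LinearMap.mulLeft ℝ ((x : R →ₗ[ℝ] R) : Module.End ℝ R)).compMultilinearMap φ -
    ∑ i, φ.compLinearMap (Function.update (fun _ => LinearMap.id) i (nabla.toLin x))
  map_add' x y := by
    ext v f
    simp only [sub_apply, add_apply, sum_apply, MultilinearMap.compLinearMap_apply,
      update_id_apply, map_add, LinearMap.add_apply, LinearMap.sub_apply,
      MultilinearMap.map_update_add, LinearMap.compMultilinearMap_apply,
      LinearMap.mulLeft_apply, Module.End.mul_apply, Derivation.coeFn_coe, Derivation.add_apply,
      Finset.sum_add_distrib]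
    abel
  map_smul' c x := by
    ext v f
    simp only [sub_apply, smul_apply, sum_apply, MultilinearMap.compLinearMap_apply,
      update_id_apply, map_smul, LinearMap.smul_apply, LinearMap.sub_apply,
      MultilinearMap.map_update_smul, LinearMap.compMultilinearMap_apply,
      LinearMap.mulLeft_apply, Module.End.mul_apply, Derivation.coeFn_coe, Derivation.smul_apply,
      Finset.smul_sum, RingHom.id_apply, smul_sub]

theorem covStep_apply {n : ℕ}
    (φ : MultilinearMap ℝ (fun _ : Fin n => VectorFields R) (Module.End ℝ R))
    (x : VectorFields R) (v : Fin n → VectorFields R) (f : R) :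
    nabla.covStep φ x v f =
      x (φ v f) - ∑ i, φ (Function.update v i (nabla.toLin x (v i))) f := by
  simp only [covStep, LinearMap.coe_mk, AddHom.coe_mk, sum_apply, sub_apply,
    MultilinearMap.compLinearMap_apply, update_id_apply, LinearMap.sub_apply,
    LinearMap.compMultilinearMap_apply, LinearMap.mulLeft_apply, Module.End.mul_apply,
    Derivation.coeFn_coe, LinearMap.sum_apply]

/-- The higher-order covariant derivatives `(x₁ ⋯ xₙ) ▷ f`, as a multilinear map in
`(x₁, …, xₙ)` with values in the linear operators on functions, by recursion on the degree `n`: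
`1 ▷ f = f` and `(x · U) ▷ f = x ▷ (U ▷ f) - (x ▷ U) ▷ f`. -/
def higherCov : (n : ℕ) → MultilinearMap ℝ (fun _ : Fin n => VectorFields R) (Module.End ℝ R)
  | 0 => MultilinearMap.constOfIsEmpty ℝ _ 1
  | n + 1 => LinearMap.uncurryLeft (nabla.covStep (higherCov n))

/-- The action `▷ : T_ℝ(V) × R → R` of the tensor algebra over `ℝ` on functions,
`nabla.act U f = U ▷ f`: the linear extension of `higherCov` to all degrees. It obeys the
recursion `act_one`, `act_ι_mul` below. -/
def act : TensorAlgebra ℝ (VectorFields R) →ₗ[ℝ] Module.End ℝ R :=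
  (DirectSum.toModule ℝ ℕ (Module.End ℝ R)
      (fun n => PiTensorProduct.lift (nabla.higherCov n))).comp
    TensorAlgebra.equivDirectSum.toLinearMap

/-- The linear map `y ↦ y + ε ∇_x y` from `V` to the dual numbers `T_ℝ(V) ⊕ ε T_ℝ(V)`. -/
def derAux (x : VectorFields R) : VectorFields R →ₗ[ℝ]
    TrivSqZeroExt (TensorAlgebra ℝ (VectorFields R)) (TensorAlgebra ℝ (VectorFields R)) where
  toFun y := TrivSqZeroExt.inl (TensorAlgebra.ι ℝ y) +
    TrivSqZeroExt.inr (TensorAlgebra.ι ℝ (nabla.toLin x y))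
  map_add' y z := by ext <;> simp
  map_smul' c y := by ext <;> simp

/-- The operator `U ↦ x ▷ U` on `T_ℝ(V)`: the derivation of the tensor algebra that extends
`y ↦ ∇_x y` (see `der_ι`, `der_mul`), obtained from the algebra morphism
`U ↦ U + ε (x ▷ U)`, `ε² = 0`. -/
def der (x : VectorFields R) :
    TensorAlgebra ℝ (VectorFields R) →ₗ[ℝ] TensorAlgebra ℝ (VectorFields R) where
  toFun U := (TensorAlgebra.lift ℝ (nabla.derAux x) U).snd
  map_add' U W := by simp
  map_smul' c U := by simp

theorem der_ι (x y : VectorFields R) :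
    nabla.der x (TensorAlgebra.ι ℝ y) = TensorAlgebra.ι ℝ (nabla.toLin x y) := by
  simp [der, derAux]

theorem der_one (x : VectorFields R) : nabla.der x 1 = 0 := by
  simp [der]

theorem lift_derAux_fst (x : VectorFields R) (U : TensorAlgebra ℝ (VectorFields R)) :
    (TensorAlgebra.lift ℝ (nabla.derAux x) U).fst = U := by
  have h : (TrivSqZeroExt.fstHom ℝ (TensorAlgebra ℝ (VectorFields R))
      (TensorAlgebra ℝ (VectorFields R))).comp (TensorAlgebra.lift ℝ (nabla.derAux x)) =
      AlgHom.id ℝ _ := by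
    ext y
    simp [derAux]
  exact DFunLike.congr_fun h U

theorem der_mul (x : VectorFields R) (U W : TensorAlgebra ℝ (VectorFields R)) :
    nabla.der x (U * W) = nabla.der x U * W + U * nabla.der x W := by
  simp only [der, LinearMap.coe_mk, AddHom.coe_mk, map_mul, TrivSqZeroExt.snd_mul,
    lift_derAux_fst, smul_eq_mul, MulOpposite.smul_eq_mul_unop, MulOpposite.unop_op]
  abel

theorem act_tprod (n : ℕ) (v : Fin n → VectorFields R) :
    nabla.act (TensorAlgebra.tprod ℝ (VectorFields R) n v) = nabla.higherCov n v := by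
  simp only [act, LinearMap.comp_apply, AlgEquiv.toLinearMap_apply]
  erw [TensorAlgebra.toDirectSum_tensorPower_tprod]
  rw [← DirectSum.lof_eq_of ℝ, DirectSum.toModule_lof, PiTensorProduct.lift.tprod]

theorem der_tprod (x : VectorFields R) (n : ℕ) (v : Fin n → VectorFields R) :
    nabla.der x (TensorAlgebra.tprod ℝ (VectorFields R) n v) =
      ∑ i, TensorAlgebra.tprod ℝ (VectorFields R) n
        (Function.update v i (nabla.toLin x (v i))) := by
  induction n with
  | zero => simp [TensorAlgebra.tprod_apply, der_one]
  | succ n ih =>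
    have key : ∀ w : Fin (n + 1) → VectorFields R,
        TensorAlgebra.tprod ℝ (VectorFields R) (n + 1) w =
          TensorAlgebra.ι ℝ (w 0) * TensorAlgebra.tprod ℝ (VectorFields R) n (Fin.tail w) := by
      intro w; simp [TensorAlgebra.tprod_apply, List.ofFn_succ, Fin.tail]
    rw [key, der_mul, der_ι, ih, Fin.sum_univ_succ, Finset.mul_sum]
    congr 1
    · rw [key]; simp
    · refine Finset.sum_congr rfl fun i _ => ?_
      rw [key, Fin.tail_update_succ, Function.update_of_ne (Fin.succ_ne_zero i).symm]
      rfl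

theorem act_one (f : R) : nabla.act 1 f = f := by
  have h := nabla.act_tprod 0 Fin.elim0
  simp only [TensorAlgebra.tprod_apply, List.ofFn_zero, List.prod_nil] at h
  rw [h]; rfl

/-- The recursion `(x · U) ▷ f = x ▷ (U ▷ f) - (x ▷ U) ▷ f`. -/
theorem act_ι_mul (x : VectorFields R) (U : TensorAlgebra ℝ (VectorFields R)) (f : R) :
    nabla.act (TensorAlgebra.ι ℝ x * U) f = x (nabla.act U f) - nabla.act (nabla.der x U) f := by
  obtain ⟨U, rfl⟩ := TensorAlgebra.equivDirectSum.symm.surjective U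
  induction U using DirectSum.induction_on with
  | zero => simp
  | add U W hU hW => simp only [map_add, mul_add, LinearMap.add_apply, hU, hW]; abel
  | of n t =>
    induction t using PiTensorProduct.induction_on with
    | add a b ha hb =>
      simp only [map_add, mul_add, LinearMap.add_apply, ha, hb]; abel
    | smul_tprod c v =>
      have h0 : TensorAlgebra.equivDirectSum.symm
          (DirectSum.of (fun n => ⨂[ℝ]^n (VectorFields R)) n
            (c • PiTensorProduct.tprod ℝ v)) =
          c • TensorAlgebra.tprod ℝ (VectorFields R) n v := by
        rw [← DirectSum.lof_eq_of ℝ, map_smul, map_smul, DirectSum.lof_eq_of]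
        congr 1
        exact TensorAlgebra.ofDirectSum_of_tprod v
      have h1 : TensorAlgebra.ι ℝ x * TensorAlgebra.tprod ℝ (VectorFields R) n v =
          TensorAlgebra.tprod ℝ (VectorFields R) (n + 1) (Fin.cons x v) := by
        simp [TensorAlgebra.tprod_apply, List.ofFn_succ]
      rw [h0, mul_smul_comm, h1]
      simp only [map_smul, LinearMap.smul_apply, act_tprod, der_tprod, map_sum,
        LinearMap.sum_apply]
      rw [higherCov, LinearMap.uncurryLeft_apply, covStep_apply]
      simp [smul_sub]

end AffineConnection

end

open scoped Manifold ContDiff TensorProduct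

section

attribute [local instance] LieRing.ofAssociativeRing

theorem TensorAlgebra.span_range_tprod (R M : Type*) [CommRing R] [AddCommGroup M] [Module R M] :
    Submodule.span R {u : TensorAlgebra R M | ∃ n v, TensorAlgebra.tprod R M n v = u} = ⊤ := by
  rw [eq_top_iff]
  rintro U -
  obtain ⟨U, rfl⟩ := TensorAlgebra.equivDirectSum.symm.surjective U
  induction U using DirectSum.induction_on with
  | zero => simp
  | add U W hU hW => rw [map_add]; exact add_mem hU hW
  | of n t =>
    induction t using PiTensorProduct.induction_on with
    | add a b ha hb => rw [map_add, map_add]; exact add_mem ha hb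
    | smul_tprod c v =>
      rw [← DirectSum.lof_eq_of R, map_smul, map_smul, DirectSum.lof_eq_of]
      exact Submodule.smul_mem _ _ (Submodule.subset_span
        ⟨n, v, (TensorAlgebra.ofDirectSum_of_tprod v).symm⟩)

theorem TensorAlgebra.tprod_cons {R M : Type*} [CommRing R] [AddCommGroup M] [Module R M] {n : ℕ}
    (x : M) (v : Fin n → M) :
    TensorAlgebra.tprod R M (n + 1) (Fin.cons x v) =
      TensorAlgebra.ι R x * TensorAlgebra.tprod R M n v := by
  simp [TensorAlgebra.tprod_apply, List.ofFn_succ]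

section

variable (R : Type*) [CommRing R] [Algebra ℝ R]

theorem piProj_ι (X : VectorFields R) :
    piProj R (TensorAlgebra.ι ℝ X) = TensorAlgebra.ι R X := by
  simp [piProj]

theorem piProj_tprod (n : ℕ) (v : Fin n → VectorFields R) :
    piProj R (TensorAlgebra.tprod ℝ (VectorFields R) n v) =
      TensorAlgebra.tprod R (VectorFields R) n v := by
  simp only [TensorAlgebra.tprod_apply, map_list_prod, List.map_ofFn]
  congr 2
  ext i
  exact piProj_ι R (v i)

/-- Over `R`, the tensor algebra of the vector fields is spanned by the image of the tensor
algebra over `ℝ`. -/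
theorem span_range_piProj : Submodule.span R (Set.range (piProj R)) = ⊤ := by
  rw [eq_top_iff, ← TensorAlgebra.span_range_tprod, Submodule.span_le]
  rintro _ ⟨n, v, rfl⟩
  exact Submodule.subset_span ⟨_, piProj_tprod R n v⟩

/-- The operators on `R` which are derivations, as an `R`-module. -/
def derivationOps : Submodule R (Module.End ℝ R) where
  carrier := {T | ∀ f g, T (f * g) = f * T g + g * T f}
  zero_mem' := by simp
  add_mem' := by
    intro S T hS hT f g
    simp only [LinearMap.add_apply, hS f g, hT f g]; ring
  smul_mem' := by
    intro c T hT f g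
    simp only [LinearMap.smul_apply, hT f g, smul_eq_mul]; ring

variable {R}

theorem mem_derivationOps {T : Module.End ℝ R} :
    T ∈ derivationOps R ↔ ∀ f g, T (f * g) = f * T g + g * T f := Iff.rfl

theorem coe_mem_derivationOps (X : VectorFields R) :
    (X : R →ₗ[ℝ] R) ∈ derivationOps R := fun f g => by simp

theorem exists_vectorField_of_mem_derivationOps {T : Module.End ℝ R} (hT : T ∈ derivationOps R) :
    ∃ X : VectorFields R, (X : R →ₗ[ℝ] R) = T :=
  ⟨Derivation.mk' T hT, rfl⟩

theorem derivationOps_lie {S T : Module.End ℝ R} (hS : S ∈ derivationOps R)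
    (hT : T ∈ derivationOps R) : S * T - T * S ∈ derivationOps R := by
  intro f g
  rw [mem_derivationOps] at hS hT
  simp only [LinearMap.sub_apply, Module.End.mul_apply, hS, hT, map_add]; ring

end

namespace AffineConnection

variable {R : Type*} [CommRing R] [Algebra ℝ R] (nabla : AffineConnection R)

theorem higherCov_succ_apply {n : ℕ} (x : Fin (n + 1) → VectorFields R) (f : R) :
    nabla.higherCov (n + 1) x f = x 0 (nabla.higherCov n (Fin.tail x) f) -
      ∑ i, nabla.higherCov n
        (Function.update (Fin.tail x) i (nabla.toLin (x 0) (Fin.tail x i))) f := by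
  rw [higherCov, LinearMap.uncurryLeft_apply, covStep_apply]

theorem higherCov_update_smul (n : ℕ) (x : Fin n → VectorFields R) (i : Fin n) (c : R)
    (X : VectorFields R) :
    nabla.higherCov n (Function.update x i (c • X)) =
      c • nabla.higherCov n (Function.update x i X) := by
  induction n generalizing c X with
  | zero => exact i.elim0
  | succ n ih =>
    ext f
    simp only [LinearMap.smul_apply, higherCov_succ_apply]
    induction i using Fin.cases with
    | zero =>
      simp only [Function.update_self, Fin.tail_update_zero, nabla.smul_left, ih,
        LinearMap.smul_apply, Derivation.smul_apply, ← Finset.smul_sum, smul_sub]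
    | succ i =>
      simp only [Fin.tail_update_succ, Function.update_of_ne (Fin.succ_ne_zero i).symm, ih]
      rw [Fintype.sum_eq_add_sum_compl i, Fintype.sum_eq_add_sum_compl i]
      have hs : ∀ Y : VectorFields R, ∀ j ∈ ({i}ᶜ : Finset (Fin n)),
          nabla.higherCov n (Function.update (Function.update (Fin.tail x) i Y) j
            (nabla.toLin (x 0) (Function.update (Fin.tail x) i Y j))) f =
          nabla.higherCov n (Function.update (Function.update (Fin.tail x) j
            (nabla.toLin (x 0) (Fin.tail x j))) i Y) f := by
        intro Y j hj
        have hj : j ≠ i := by simpa using hj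
        rw [Function.update_of_ne hj, Function.update_comm hj]
      rw [Finset.sum_congr rfl (hs _), Finset.sum_congr rfl (hs _)]
      simp only [Function.update_self, Function.update_idem, nabla.leibniz,
        MultilinearMap.map_update_add, ih, LinearMap.add_apply, LinearMap.smul_apply, smul_eq_mul,
        Derivation.leibniz, ← Finset.mul_sum]
      ring

/-- The higher covariant derivatives as an `R`-multilinear map. -/
def tensorialCov (n : ℕ) :
    MultilinearMap R (fun _ : Fin n => VectorFields R) (Module.End ℝ R) where
  toFun := nabla.higherCov n
  map_update_add' x i X Y := by
    convert (nabla.higherCov n).map_update_add x i X Y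
  map_update_smul' x i c X := by
    convert nabla.higherCov_update_smul n x i c X

theorem tensorialCov_apply (n : ℕ) (x : Fin n → VectorFields R) :
    nabla.tensorialCov n x = nabla.higherCov n x := rfl

/-- The action of the tensor algebra over `R`. -/
def rho : TensorFields R →ₗ[R] Module.End ℝ R :=
  (DirectSum.toModule R ℕ (Module.End ℝ R)
      (fun n => PiTensorProduct.lift (nabla.tensorialCov n))).comp
    TensorAlgebra.equivDirectSum.toLinearMap

theorem rho_tprod (n : ℕ) (v : Fin n → VectorFields R) :
    nabla.rho (TensorAlgebra.tprod R (VectorFields R) n v) = nabla.higherCov n v := by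
  simp only [rho, LinearMap.comp_apply, AlgEquiv.toLinearMap_apply]
  erw [TensorAlgebra.toDirectSum_tensorPower_tprod]
  rw [← DirectSum.lof_eq_of R, DirectSum.toModule_lof, PiTensorProduct.lift.tprod,
    tensorialCov_apply]

theorem rho_piProj (U : TensorAlgebra ℝ (VectorFields R)) :
    nabla.rho (piProj R U) = nabla.act U := by
  have h : (nabla.rho.restrictScalars ℝ).comp (piProj R).toLinearMap = nabla.act := by
    apply LinearMap.ext_on (TensorAlgebra.span_range_tprod ℝ (VectorFields R))
    rintro _ ⟨n, v, rfl⟩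
    simp only [LinearMap.comp_apply, LinearMap.restrictScalars_apply, AlgHom.toLinearMap_apply,
      piProj_tprod, rho_tprod, act_tprod]
  exact DFunLike.congr_fun h U

theorem act_ι (X : VectorFields R) :
    nabla.act (TensorAlgebra.ι ℝ X) = (X : R →ₗ[ℝ] R) := by
  ext f
  simpa [der_one, act_one] using nabla.act_ι_mul X 1 f

theorem rho_ι (X : VectorFields R) :
    nabla.rho (TensorAlgebra.ι R X) = (X : R →ₗ[ℝ] R) := by
  rw [← piProj_ι, rho_piProj, act_ι]

theorem smul_eq_mulLeft_mul (c : R) (T : Module.End ℝ R) :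
    c • T = LinearMap.mulLeft ℝ c * T := by
  ext f; simp

theorem higherCov_mem_diffOps (n : ℕ) (v : Fin n → VectorFields R) :
    nabla.higherCov n v ∈ diffOps R := by
  induction n with
  | zero => exact one_mem _
  | succ n ih =>
    have h : nabla.higherCov (n + 1) v =
        ((v 0 : R →ₗ[ℝ] R) : Module.End ℝ R) * nabla.higherCov n (Fin.tail v) -
        ∑ i, nabla.higherCov n
          (Function.update (Fin.tail v) i (nabla.toLin (v 0) (Fin.tail v i))) := by
      ext f
      simp [higherCov_succ_apply]
    rw [h]
    exact sub_mem (mul_mem (Algebra.subset_adjoin (Or.inl ⟨v 0, rfl⟩)) (ih _))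
      (sum_mem fun i _ => ih _)

theorem rho_mem_diffOps (a : TensorFields R) : nabla.rho a ∈ diffOps R := by
  have ha : a ∈ Submodule.span R
      {u : TensorFields R | ∃ n v, TensorAlgebra.tprod R (VectorFields R) n v = u} := by
    rw [TensorAlgebra.span_range_tprod]; trivial
  induction ha using Submodule.span_induction with
  | mem a ha =>
    obtain ⟨n, v, rfl⟩ := ha
    rw [rho_tprod]
    exact nabla.higherCov_mem_diffOps n v
  | zero => rw [map_zero]; exact zero_mem _
  | add a b _ _ ha hb => rw [map_add]; exact add_mem ha hb
  | smul c a _ ha =>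
    rw [map_smul, smul_eq_mulLeft_mul]
    exact mul_mem (Algebra.subset_adjoin (Or.inr ⟨c, rfl⟩)) ha

theorem vectorField_mul_mem_range_rho (X : VectorFields R) {T : Module.End ℝ R}
    (hT : T ∈ LinearMap.range nabla.rho) :
    ((X : R →ₗ[ℝ] R) : Module.End ℝ R) * T ∈ LinearMap.range nabla.rho := by
  obtain ⟨a, rfl⟩ := hT
  have ha : a ∈ Submodule.span R (Set.range (piProj R)) := by
    rw [span_range_piProj]; trivial
  induction ha using Submodule.span_induction with
  | mem a ha =>
    obtain ⟨U, rfl⟩ := ha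
    refine ⟨piProj R (TensorAlgebra.ι ℝ X * U + nabla.der X U), ?_⟩
    ext f
    simp only [rho_piProj, map_add, LinearMap.add_apply, act_ι_mul]
    simp
  | zero => simp
  | add a b _ _ ha hb => rw [map_add, mul_add]; exact add_mem ha hb
  | smul c a _ ha =>
    have h : ((X : R →ₗ[ℝ] R) : Module.End ℝ R) * nabla.rho (c • a) =
        X c • nabla.rho a + c • (((X : R →ₗ[ℝ] R) : Module.End ℝ R) * nabla.rho a) := by
      ext f
      simp [mul_comm, add_comm]
    rw [h]
    exact add_mem (Submodule.smul_mem _ _ ⟨a, rfl⟩) (Submodule.smul_mem _ _ ha)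

theorem range_rho : Set.range nabla.rho = (diffOps R : Set (Module.End ℝ R)) := by
  apply subset_antisymm
  · rintro _ ⟨a, rfl⟩
    exact nabla.rho_mem_diffOps a
  · intro T hT
    have key : ∀ S ∈ LinearMap.range nabla.rho, T * S ∈ LinearMap.range nabla.rho := by
      induction hT using Algebra.adjoin_induction with
      | mem T hT =>
        rintro S hS
        rcases hT with ⟨X, rfl⟩ | ⟨c, rfl⟩
        · exact nabla.vectorField_mul_mem_range_rho X hS
        · exact smul_eq_mulLeft_mul c S ▸ Submodule.smul_mem _ c hS
      | algebraMap r =>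
        intro S hS
        rw [← Algebra.smul_def, ← algebraMap_smul R r S]
        exact Submodule.smul_mem _ _ hS
      | add T T' _ _ h h' => intro S hS; rw [add_mul]; exact add_mem (h S hS) (h' S hS)
      | mul T T' _ _ h h' => intro S hS; rw [mul_assoc]; exact h _ (h' S hS)
    have h1 : (1 : Module.End ℝ R) ∈ LinearMap.range nabla.rho :=
      ⟨piProj R 1, by ext f; rw [rho_piProj, act_one]; rfl⟩
    simpa using key 1 h1

end AffineConnection

section

variable {R : Type*} [CommRing R] [Algebra ℝ R]

/-- An operator on `T_ℝ(V)` which is the extension as a derivation of an operator on `V`. -/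
structure IsTensorDerivation (D : Module.End ℝ (TensorAlgebra ℝ (VectorFields R))) : Prop where
  leibniz : ∀ U W, D (U * W) = D U * W + U * D W
  map_ι : ∀ X, D (TensorAlgebra.ι ℝ X) ∈
    LinearMap.range (TensorAlgebra.ι ℝ (M := VectorFields R))

namespace IsTensorDerivation

variable {D D' : Module.End ℝ (TensorAlgebra ℝ (VectorFields R))}

theorem zero : IsTensorDerivation (0 : Module.End ℝ (TensorAlgebra ℝ (VectorFields R))) where
  leibniz := by simp
  map_ι := by simp

theorem add (h : IsTensorDerivation D) (h' : IsTensorDerivation D') :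
    IsTensorDerivation (D + D') where
  leibniz U W := by simp only [LinearMap.add_apply, h.leibniz, h'.leibniz]; noncomm_ring
  map_ι X := add_mem (h.map_ι X) (h'.map_ι X)

theorem smul (c : ℝ) (h : IsTensorDerivation D) : IsTensorDerivation (c • D) where
  leibniz U W := by simp only [LinearMap.smul_apply, h.leibniz]; simp
  map_ι X := Submodule.smul_mem _ c (h.map_ι X)

theorem lie_sub {D'' : Module.End ℝ (TensorAlgebra ℝ (VectorFields R))}
    (h : IsTensorDerivation D) (h' : IsTensorDerivation D') (h'' : IsTensorDerivation D'') :
    IsTensorDerivation (D * D' - D' * D - D'') where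
  leibniz U W := by
    simp only [LinearMap.sub_apply, Module.End.mul_apply, h.leibniz, h'.leibniz, h''.leibniz,
      map_add]
    noncomm_ring
  map_ι X := by
    obtain ⟨Y, hY⟩ := h.map_ι X
    obtain ⟨Z, hZ⟩ := h'.map_ι X
    simp only [LinearMap.sub_apply, Module.End.mul_apply, ← hY, ← hZ]
    exact sub_mem (sub_mem (h.map_ι Z) (h'.map_ι Y)) (h''.map_ι X)

end IsTensorDerivation

variable (R) in
/-- The span of the iterated commutators `[X₀, [X₁, …, [Xₙ₋₁, Xₙ]]]` in `T_ℝ(V)`. -/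
def iteratedLie : ℕ → Submodule ℝ (TensorAlgebra ℝ (VectorFields R))
  | 0 => LinearMap.range (TensorAlgebra.ι ℝ (M := VectorFields R))
  | n + 1 => Submodule.span ℝ {u | ∃ X, ∃ w ∈ iteratedLie n,
      TensorAlgebra.ι ℝ X * w - w * TensorAlgebra.ι ℝ X = u}

theorem IsTensorDerivation.map_mem_iteratedLie
    {D : Module.End ℝ (TensorAlgebra ℝ (VectorFields R))} (h : IsTensorDerivation D) (n : ℕ)
    {u : TensorAlgebra ℝ (VectorFields R)} (hu : u ∈ iteratedLie R n) :
    D u ∈ iteratedLie R n := by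
  induction n generalizing u with
  | zero =>
    obtain ⟨X, rfl⟩ := hu
    exact h.map_ι X
  | succ n ih =>
    induction hu using Submodule.span_induction with
    | mem u hu =>
      obtain ⟨X, w, hw, rfl⟩ := hu
      obtain ⟨Y, hY⟩ := h.map_ι X
      have e : D (TensorAlgebra.ι ℝ X * w - w * TensorAlgebra.ι ℝ X) =
          (TensorAlgebra.ι ℝ Y * w - w * TensorAlgebra.ι ℝ Y) +
          (TensorAlgebra.ι ℝ X * D w - D w * TensorAlgebra.ι ℝ X) := by
        rw [map_sub, h.leibniz, h.leibniz, hY]; abel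
      rw [e]
      exact add_mem (Submodule.subset_span ⟨Y, w, hw, rfl⟩)
        (Submodule.subset_span ⟨X, D w, ih hw, rfl⟩)
    | zero => simp
    | add a b _ _ ha hb => rw [map_add]; exact add_mem ha hb
    | smul c a _ ha => rw [map_smul]; exact Submodule.smul_mem _ _ ha

theorem mem_span_iteratedLie {a : TensorFields R} (ha : a ∈ lieFields R) :
    a ∈ Submodule.span R (⋃ n, piProj R '' (iteratedLie R n)) := by
  set N := Submodule.span R (⋃ n, piProj R '' (iteratedLie R n)) with hN
  let K : LieSubalgebra R (TensorFields R) :=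
    { carrier := {a | a ∈ N ∧ ∀ b ∈ N, ⁅a, b⁆ ∈ N}
      zero_mem' := ⟨zero_mem _, fun b _ => by rw [zero_lie]; exact zero_mem _⟩
      add_mem' := fun ha hb => ⟨add_mem ha.1 hb.1, fun c hc => by
        rw [add_lie]; exact add_mem (ha.2 c hc) (hb.2 c hc)⟩
      smul_mem' := fun r a ha => ⟨Submodule.smul_mem _ _ ha.1, fun c hc => by
        rw [smul_lie]; exact Submodule.smul_mem _ _ (ha.2 c hc)⟩
      lie_mem' := fun ha hb => ⟨ha.2 _ hb.1, fun c hc => by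
        rw [lie_lie]
        exact sub_mem (ha.2 _ (hb.2 c hc)) (hb.2 _ (ha.2 c hc))⟩ }
  have hK : lieFields R ≤ K := by
    refine LieSubalgebra.lieSpan_le.mpr ?_
    rintro _ ⟨X, rfl⟩
    refine ⟨Submodule.subset_span (Set.mem_iUnion.mpr
      ⟨0, TensorAlgebra.ι ℝ X, ⟨X, rfl⟩, piProj_ι R X⟩), fun b hb => ?_⟩
    induction hb using Submodule.span_induction with
    | mem b hb =>
      obtain ⟨n, w, hw, rfl⟩ := Set.mem_iUnion.mp hb
      refine Submodule.subset_span (Set.mem_iUnion.mpr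
        ⟨n + 1, _, Submodule.subset_span ⟨X, w, hw, rfl⟩, ?_⟩)
      simp only [map_sub, map_mul, piProj_ι, LieRing.of_associative_ring_bracket]
    | zero => rw [lie_zero]; exact zero_mem _
    | add a b _ _ ha hb => rw [lie_add]; exact add_mem ha hb
    | smul c a _ ha => rw [lie_smul]; exact Submodule.smul_mem _ _ ha
  exact (hK ha).1

end

namespace AffineConnection

variable {R : Type*} [CommRing R] [Algebra ℝ R] (nabla : AffineConnection R)

theorem isTensorDerivation_der (X : VectorFields R) : IsTensorDerivation (nabla.der X) where
  leibniz := nabla.der_mul X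
  map_ι Y := ⟨_, (nabla.der_ι X Y).symm⟩

/-- The tensors `u` which act on `R` by a derivation and satisfy
`(u · W) ▷ f = u ▷ (W ▷ f) - (D W) ▷ f` for some derivation `D` of the tensor algebra. -/
def derivationTensors : Submodule ℝ (TensorAlgebra ℝ (VectorFields R)) where
  carrier := {u | nabla.act u ∈ derivationOps R ∧ ∃ D, IsTensorDerivation D ∧
    ∀ W, nabla.act (u * W) = nabla.act u * nabla.act W - nabla.act (D W)}
  zero_mem' := ⟨by rw [map_zero]; exact zero_mem _, 0, .zero, by simp⟩
  add_mem' := by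
    rintro u w ⟨hu, D, hD, h⟩ ⟨hw, D', hD', h'⟩
    refine ⟨by rw [map_add]; exact add_mem hu hw, D + D', hD.add hD', fun W => ?_⟩
    simp only [add_mul, map_add, h, h', LinearMap.add_apply]; abel
  smul_mem' := by
    rintro c u ⟨hu, D, hD, h⟩
    refine ⟨?_, c • D, hD.smul c, fun W => ?_⟩
    · rw [map_smul, ← algebraMap_smul R c (nabla.act u)]
      exact Submodule.smul_mem _ _ hu
    · simp only [smul_mul_assoc, map_smul, h, LinearMap.smul_apply, smul_sub]

theorem act_ι_mul_eq (X : VectorFields R) (U : TensorAlgebra ℝ (VectorFields R)) :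
    nabla.act (TensorAlgebra.ι ℝ X * U) =
      nabla.act (TensorAlgebra.ι ℝ X) * nabla.act U - nabla.act (nabla.der X U) := by
  ext f
  rw [act_ι_mul, act_ι]; rfl

theorem iteratedLie_le_derivationTensors (n : ℕ) :
    iteratedLie R n ≤ nabla.derivationTensors := by
  induction n with
  | zero =>
    rintro _ ⟨X, rfl⟩
    exact ⟨by rw [act_ι]; exact coe_mem_derivationOps X, nabla.der X,
      nabla.isTensorDerivation_der X, nabla.act_ι_mul_eq X⟩
  | succ n ih =>
    refine Submodule.span_le.mpr ?_
    rintro _ ⟨X, w, hw, rfl⟩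
    obtain ⟨hw', D, hD, h⟩ := ih hw
    have hX := nabla.isTensorDerivation_der X
    obtain ⟨Y, hY⟩ := hD.map_ι X
    set x := TensorAlgebra.ι ℝ X
    have hz : nabla.der X w - D x ∈ nabla.derivationTensors :=
      sub_mem (ih (hX.map_mem_iteratedLie n hw))
        (hY ▸ ⟨by rw [act_ι]; exact coe_mem_derivationOps Y, nabla.der Y,
          nabla.isTensorDerivation_der Y, nabla.act_ι_mul_eq Y⟩)
    obtain ⟨hz', D', hD', h'⟩ := hz
    set z := nabla.der X w - D x with hz
    have key : ∀ W, nabla.act ((x * w - w * x) * W) =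
        (nabla.act x * nabla.act w - nabla.act w * nabla.act x) * nabla.act W -
          nabla.act ((nabla.der X * D - D * nabla.der X) W) - nabla.act (z * W) := by
      intro W
      have e1 := nabla.act_ι_mul_eq X (w * W)
      have e2 := nabla.act_ι_mul_eq X (D W)
      have e3 := h (x * W)
      have e4 := h (nabla.der X W)
      rw [hX.leibniz, h, map_add, e4] at e1
      rw [hD.leibniz, nabla.act_ι_mul_eq, map_add, e2] at e3
      simp only [hz, sub_mul, mul_assoc, map_sub]
      rw [e1, e3]
      simp only [x, LinearMap.sub_apply, Module.End.mul_apply, map_sub]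
      noncomm_ring
    have key1 : nabla.act (x * w - w * x) =
        nabla.act x * nabla.act w - nabla.act w * nabla.act x - nabla.act z := by
      have h1 : nabla.act 1 = 1 := by ext f; rw [act_one]; rfl
      have hX1 : nabla.der X 1 = 0 := nabla.der_one X
      have hD1 : D 1 = 0 := by simpa using hD.leibniz 1 1
      simpa [h1, hX1, hD1] using key 1
    refine ⟨?_, _, hX.lie_sub hD hD', fun W => ?_⟩
    · rw [key1]
      refine sub_mem (derivationOps_lie ?_ hw') hz'
      rw [act_ι]
      exact coe_mem_derivationOps X
    · rw [key, key1, h', sub_mul _ (nabla.act z), LinearMap.sub_apply _ D', map_sub nabla.act _ (D' W)]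
      abel

theorem rho_image_lieFields : nabla.rho '' (lieFields R : Set (TensorFields R)) =
    Set.range (fun X : VectorFields R => (X : R →ₗ[ℝ] R)) := by
  apply subset_antisymm
  · rintro _ ⟨a, ha, rfl⟩
    refine exists_vectorField_of_mem_derivationOps ?_
    have h : Submodule.span R (⋃ n, piProj R '' (iteratedLie R n)) ≤
        (derivationOps R).comap nabla.rho := by
      rw [Submodule.span_le, Set.iUnion_subset_iff]
      rintro n _ ⟨u, hu, rfl⟩
      rw [SetLike.mem_coe, Submodule.mem_comap, rho_piProj]
      exact (nabla.iteratedLie_le_derivationTensors n hu).1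
    exact h (mem_span_iteratedLie ha)
  · rintro _ ⟨X, rfl⟩
    exact ⟨_, LieSubalgebra.subset_lieSpan ⟨X, rfl⟩, nabla.rho_ι X⟩

end AffineConnection

end

theorem mainTheorem8
    {E : Type*} [NormedAddCommGroup E] [NormedSpace ℝ E] [FiniteDimensional ℝ E]
    {H : Type*} [TopologicalSpace H] (I : ModelWithCorners ℝ E H)
    (M : Type*) [TopologicalSpace M] [ChartedSpace H M] [IsManifold I ∞ M]
    [T2Space M] [SecondCountableTopology M]
    (nabla : AffineConnection C^∞⟮I, M; 𝓘(ℝ, ℝ), ℝ⟯) :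
    -- `(x₁ ⋯ xₙ) ▷ f` is `C^∞(M)`-linear in each of the arguments `x₁, …, xₙ`
    (∀ n : ℕ, ∃ Φ : MultilinearMap C^∞⟮I, M; 𝓘(ℝ, ℝ), ℝ⟯
        (fun _ : Fin n => VectorFields C^∞⟮I, M; 𝓘(ℝ, ℝ), ℝ⟯)
        (Module.End ℝ C^∞⟮I, M; 𝓘(ℝ, ℝ), ℝ⟯),
      ∀ x : Fin n → VectorFields C^∞⟮I, M; 𝓘(ℝ, ℝ), ℝ⟯,
        Φ x = nabla.act
          (TensorAlgebra.tprod ℝ (VectorFields C^∞⟮I, M; 𝓘(ℝ, ℝ), ℝ⟯) n x)) ∧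
    -- the action factors through `A = T_R(V)`, by a `C^∞(M)`-linear map `ρ`
    (∃ ρ : TensorFields C^∞⟮I, M; 𝓘(ℝ, ℝ), ℝ⟯ →ₗ[C^∞⟮I, M; 𝓘(ℝ, ℝ), ℝ⟯]
        Module.End ℝ C^∞⟮I, M; 𝓘(ℝ, ℝ), ℝ⟯,
      (∀ (U : TensorAlgebra ℝ (VectorFields C^∞⟮I, M; 𝓘(ℝ, ℝ), ℝ⟯))
          (f : C^∞⟮I, M; 𝓘(ℝ, ℝ), ℝ⟯),
        ρ (piProj C^∞⟮I, M; 𝓘(ℝ, ℝ), ℝ⟯ U) f = nabla.act U f) ∧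
      -- `ρ` extends the identity of `V`
      (∀ (X : VectorFields C^∞⟮I, M; 𝓘(ℝ, ℝ), ℝ⟯) (f : C^∞⟮I, M; 𝓘(ℝ, ℝ), ℝ⟯),
        ρ (TensorAlgebra.ι C^∞⟮I, M; 𝓘(ℝ, ℝ), ℝ⟯ X) f = X f) ∧
      -- `ρ` maps `A` onto the differential operators
      Set.range ρ = (diffOps C^∞⟮I, M; 𝓘(ℝ, ℝ), ℝ⟯ :
        Set (Module.End ℝ C^∞⟮I, M; 𝓘(ℝ, ℝ), ℝ⟯)) ∧
      -- `ρ` maps `g` onto the vector fields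
      ρ '' (lieFields C^∞⟮I, M; 𝓘(ℝ, ℝ), ℝ⟯ :
          Set (TensorFields C^∞⟮I, M; 𝓘(ℝ, ℝ), ℝ⟯)) =
        Set.range (fun X : VectorFields C^∞⟮I, M; 𝓘(ℝ, ℝ), ℝ⟯ =>
          (X : C^∞⟮I, M; 𝓘(ℝ, ℝ), ℝ⟯ →ₗ[ℝ] C^∞⟮I, M; 𝓘(ℝ, ℝ), ℝ⟯))) :=
  ⟨fun n => ⟨nabla.tensorialCov n, fun x => (nabla.act_tprod n x).symm⟩,
    nabla.rho, fun U f => by rw [nabla.rho_piProj], fun X f => by rw [nabla.rho_ι]; rfl,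
    nabla.range_rho, nabla.rho_image_lieFields⟩
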